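/- Let $P = S_1 \times \dots \times S_N$ be a product of finitely many finite totally ordered sets, with the product partial order, let $\mathbb{F}$ be a field, and let $F \colon P \to \mathsf{Vec}_{\mathbb{F}}$ be a functor such that $F(x)$ is finite-dimensional for every $x \in P$. Suppose that $F$ is $k$-middle-exact for all $2 \le k \le N$. Then $F$ is interval decomposable. Here a $k$-cube in a category $\mathscr{C}$ is a functor $\mathcal{X}$ from the poset of subsets of $\{0,\dots,k-1\}$ to $\mathscr{C}$. It is strongly bicartesian if for all $A \subseteq B \subseteq \{0,\dots,k-1\}$ with $|B \setminus A| \ge 2$ the canonical maps $\operatorname{colim}_{A \subseteq S \subsetneq B} \mathcal{X}(S) \to \mathcal{X}(B)$ and $\mathcal{X}(A) \to \lim_{A \subsetneq S \subseteq B} \mathcal{X}(S)$ are isomorphisms. The Koszul complex of a $k$-cube $\mathcal{X}$ in $\mathsf{Vec}_{\mathbb{F}}$ is the chain complex $(K_{\mathcal{X}})_i = \bigoplus_{|S| = k-i} \mathcal{X}(S)$ whose differential $(K_{\mathcal{X}})_{i+1} \to (K_{\mathcal{X}})_i$ is given on the summand $\mathcal{X}(S)$ by $\sum_{j=0}^{i}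 (-1)^j \mathcal{X}(S \subseteq S \cup \{t_j\})$, where $t_0 < \dots < t_i$ are the elements of the complement of $S$. The functor $F$ is $k$-middle-exact if for every strongly bicartesian $k$-cube $\mathcal{X}$ in $P$ the Koszul complex of $F \circ \mathcal{X}$ has trivial homology in all degrees $0 < i < k$. An interval in $P$ is a nonempty subset $I \subseteq P$ such that $x \le z \le y$ with $x, y \in I$ implies $z \in I$, and such that any two elements of $I$ are connected by a finite zigzag $x = a_0 \le b_0 \ge a_1 \le \dots \le b_n = y$ of elements of $I$. The interval module $\mathbb{F}_I \colon P \to \mathsf{Vec}_{\mathbb{F}}$ is $\mathbb{F}$ at the points of $I$ and $0$ elsewhere, with identity maps between points of $I$ and zero maps otherwise. The functor $F$ is interval decomposable if it is isomorphic to a direct sum $\bigoplus_{j \in J} \mathbb{F}_{I_j}$ for some family $(I_j)_{j\in J}$ of intervals in $P$ (repetitions allowed). -/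

import Mathlib

open CategoryTheory Limits

open scoped DirectSum

universe u v w

noncomputable section

namespace Persistence

/-! ### Interval modules and interval decomposability -/

/-- An interval of a poset `P`: a nonempty subset which is convex and in which any two elements are
joined by a finite zigzag of comparable elements of the subset. -/
structure PosetInterval (P : Type v) [PartialOrder P] where
  /-- The underlying subset. -/
  carrier : Set P
  nonempty : carrier.Nonempty
  convex : ∀ ⦃x y z : P⦄, x ∈ carrier → y ∈ carrier → x ≤ z → z ≤ y → z ∈ carrier
  zigzag : ∀ ⦃x y : P⦄, x ∈ carrier → y ∈ carrier →
    Relation.ReflTransGen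
      (fun a b => a ∈ carrier ∧ b ∈ carrier ∧ (a ≤ b ∨ b ≤ a)) x y

open Classical in
/-- The value of the interval module at `x`: the line `K` (the subspace `⊤` of `K`) if `x ∈ I`, and
zero (the subspace `⊥` of `K`) otherwise. -/
def intervalFiber (K : Type u) [Field K] {P : Type v} [PartialOrder P] (I : PosetInterval P)
    (x : P) : Submodule K K :=
  if x ∈ I.carrier then ⊤ else ⊥

open Classical in
/-- The structure map of the interval module from `x` to `y`: the identity of `K` if `x, y ∈ I`, and
zero otherwise. -/
def intervalMap (K : Type u) [Field K] {P : Type v} [PartialOrder P] (I : PosetInterval P)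
    (x y : P) : intervalFiber K I x →ₗ[K] intervalFiber K I y :=
  if h : x ∈ I.carrier ∧ y ∈ I.carrier then
    Submodule.inclusion (by simp [intervalFiber, h.1, h.2])
  else 0

/-- The interval module `K_I` of an interval `I`. -/
def intervalModule (K : Type u) [Field K] {P : Type v} [PartialOrder P] (I : PosetInterval P) :
    P ⥤ ModuleCat.{u} K where
  obj x := ModuleCat.of K (intervalFiber K I x)
  map {x y} _ := ModuleCat.ofHom (intervalMap K I x y)
  map_id x := by
    by_cases hx : x ∈ I.carrier
    · ext a
      simp [intervalMap, hx]
    · have : Subsingleton (intervalFiber K I x) := by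
        simp only [intervalFiber, hx, if_false]
        infer_instance
      ext a
      exact congrArg Subtype.val (Subsingleton.elim (α := intervalFiber K I x) _ _)
  map_comp {x y z} f g := by
    rw [← ModuleCat.ofHom_comp]
    congr 1
    by_cases hx : x ∈ I.carrier <;> by_cases hz : z ∈ I.carrier
    · have hy : y ∈ I.carrier := I.convex hx hz (leOfHom f) (leOfHom g)
      ext a
      simp [intervalMap, hx, hy, hz]
    all_goals
      ext a
      simp [intervalMap, hx, hz]

/-- A persistence module is interval decomposable if it is isomorphic to a direct sum of a family
(repetitions allowed) of interval modules. -/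
def IsIntervalDecomposable {K : Type u} [Field K] {P : Type v} [PartialOrder P]
    (F : P ⥤ ModuleCat.{u} K) : Prop :=
  ∃ (ι : Type u) (I : ι → PosetInterval P),
    Nonempty (F ≅ ∐ fun i => intervalModule K (I i))

/-- Pointwise finite-dimensional persistence modules. -/
def IsPFD {K : Type u} [Field K] {P : Type v} [PartialOrder P]
    (F : P ⥤ ModuleCat.{u} K) : Prop :=
  ∀ x : P, FiniteDimensional K (F.obj x)

/-! ### Cubes -/

/-- A `k`-cube in `C`: a functor to `C` from the poset of subsets of a `k`-element set. -/
abbrev Cube (k : ℕ) (C : Type w) [Category.{v} C] := Finset (Fin k) ⥤ C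

/-- The face of the cube `X` spanned by `A ⊆ B` consists of the `X(S)` with `A ⊆ S ⊆ B`. This is the
canonical cocone with point `X(B)` on the punctured face `A ⊆ S ⊊ B`. -/
def faceCocone {k : ℕ} {C : Type w} [Category.{v} C] (X : Cube k C)
    (A B : Finset (Fin k)) : Cocone ((Subtype.mono_coe (· ∈ Set.Ico A B)).functor ⋙ X) where
  pt := X.obj B
  ι :=
    { app := fun S => X.map (homOfLE S.2.2.le)
      naturality := fun S T f => by
        refine Eq.trans ?_ (Category.comp_id _).symm
        exact (X.map_comp _ _).symm }

/-- The canonical cone with point `X(A)` on the punctured face `A ⊊ S ⊆ B`. -/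
def faceCone {k : ℕ} {C : Type w} [Category.{v} C] (X : Cube k C)
    (A B : Finset (Fin k)) : Cone ((Subtype.mono_coe (· ∈ Set.Ioc A B)).functor ⋙ X) where
  pt := X.obj A
  π :=
    { app := fun S => X.map (homOfLE S.2.1.le)
      naturality := fun S T f => by
        refine (Category.id_comp _).trans ?_
        exact X.map_comp _ _ }

/-- Every face of dimension at least two is cocartesian. -/
def IsStronglyCocartesian {k : ℕ} {C : Type w} [Category.{v} C] (X : Cube k C) :
    Prop :=
  ∀ A B : Finset (Fin k), A ⊆ B → 2 ≤ (B \ A).card → Nonempty (IsColimit (faceCocone X A B))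

/-- Every face of dimension at least two is cartesian. -/
def IsStronglyCartesian {k : ℕ} {C : Type w} [Category.{v} C] (X : Cube k C) :
    Prop :=
  ∀ A B : Finset (Fin k), A ⊆ B → 2 ≤ (B \ A).card → Nonempty (IsLimit (faceCone X A B))

/-- Strongly bicartesian cubes. -/
def IsStronglyBicartesian {k : ℕ} {C : Type w} [Category.{v} C] (X : Cube k C) :
    Prop :=
  IsStronglyCartesian X ∧ IsStronglyCocartesian X

/-! ### The Koszul complex -/

/-- The subsets of `Fin k` with `k - i` elements (there are none if `i > k`). -/
abbrev KoszulIndex (k i : ℕ) := {S : Finset (Fin k) // S.card + i = k}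

/-- `S ∪ {t}` as an index in degree `i`, for `S` an index in degree `i + 1` and `t ∉ S`. -/
def KoszulIndex.insert {k i : ℕ} (S : KoszulIndex k (i + 1)) (t : {t : Fin k // t ∉ S.1}) :
    KoszulIndex k i :=
  ⟨Insert.insert t.1 S.1, by
    have h := S.2
    rw [Finset.card_insert_of_notMem t.2]
    omega⟩

theorem KoszulIndex.le_insert {k i : ℕ} (S : KoszulIndex k (i + 1)) (t : {t : Fin k // t ∉ S.1}) :
    S.1 ≤ (S.insert t).1 :=
  Finset.subset_insert t.1 S.1

/-- The sign `(-1) ^ j`, where `j` is the position of `t` in the increasing enumeration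
`t_0 < t_1 < ...` of the complement of `S`. -/
def koszulSign {k : ℕ} (S : Finset (Fin k)) (t : Fin k) : ℤ :=
  (-1) ^ (Sᶜ.filter (· < t)).card

/-- The Koszul complex in degree `i`: the direct sum of the `X(S)` over the `S` with `k - i`
elements. -/
abbrev KoszulObj {K : Type u} [Field K] {k : ℕ}
    (X : Cube k (ModuleCat.{u} K)) (i : ℕ) : Type u := ⨁ S : KoszulIndex k i, X.obj S.1

/-- The differential, given on the summand `X(S)` by the sum over `t ∉ S` of `(-1) ^ j` times
`X(S ⊆ S ∪ {t})`, where `t = t_j`. -/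
def koszulD {K : Type u} [Field K] {k : ℕ}
    (X : Cube k (ModuleCat.{u} K)) (i : ℕ) : KoszulObj X (i + 1) →ₗ[K] KoszulObj X i :=
  DirectSum.toModule K (KoszulIndex k (i + 1)) (KoszulObj X i) fun S =>
    ∑ t : {t : Fin k // t ∉ S.1}, koszulSign S.1 t.1 •
      (DirectSum.lof K (KoszulIndex k i) (fun T => X.obj T.1) (S.insert t) ∘ₗ
        (X.map (homOfLE (S.le_insert t))).hom)

theorem koszulSign_insert {k : ℕ} (S : Finset (Fin k)) (t u : Fin k) (ht : t ∉ S) :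
    koszulSign (Insert.insert t S) u = if t < u then -koszulSign S u else koszulSign S u := by
  unfold koszulSign
  have h1 : (Insert.insert t S)ᶜ.filter (· < u) = (Sᶜ.filter (· < u)).erase t := by
    ext s
    simp only [Finset.mem_filter, Finset.mem_compl, Finset.mem_insert, Finset.mem_erase]
    tauto
  rw [h1]
  split_ifs with h
  · have hm : t ∈ Sᶜ.filter (· < u) := by simp [ht, h]
    rw [← Finset.card_erase_add_one hm, pow_succ]
    simp
  · rw [Finset.erase_eq_of_notMem]
    simp [h]

theorem koszulSign_swap {k : ℕ} (S : Finset (Fin k)) (t u : Fin k) (ht : t ∉ S) (hu : u ∉ S)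
    (h : t ≠ u) :
    koszulSign S t * koszulSign (Insert.insert t S) u +
      koszulSign S u * koszulSign (Insert.insert u S) t = 0 := by
  rw [koszulSign_insert S t u ht, koszulSign_insert S u t hu]
  rcases lt_or_gt_of_ne h with h' | h'
  · rw [if_pos h', if_neg (not_lt.2 h'.le)]
    ring
  · rw [if_pos h', if_neg (not_lt.2 h'.le)]
    ring

theorem koszulD_lof {K : Type u} [Field K] {k : ℕ} (X : Cube k (ModuleCat.{u} K)) (i : ℕ)
    (S : KoszulIndex k (i + 1)) (x : X.obj S.1) :
    koszulD X i (DirectSum.lof K _ (fun T : KoszulIndex k (i + 1) => X.obj T.1) S x) =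
      ∑ t : {t : Fin k // t ∉ S.1}, koszulSign S.1 t.1 •
        DirectSum.lof K (KoszulIndex k i) (fun T => X.obj T.1) (S.insert t)
          ((X.map (homOfLE (S.le_insert t))).hom x) := by
  rw [koszulD, DirectSum.toModule_lof]
  simp

theorem koszul_lof_congr {K : Type u} [Field K] {k : ℕ} (X : Cube k (ModuleCat.{u} K)) (i : ℕ)
    {S A A' : Finset (Fin k)} (x : X.obj S) {T T' : KoszulIndex k i} (f : S ⟶ A) (g : A ⟶ T.1)
    (f' : S ⟶ A') (g' : A' ⟶ T'.1) (h : T = T') :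
    DirectSum.lof K (KoszulIndex k i) (fun T => X.obj T.1) T
        ((X.map g).hom ((X.map f).hom x)) =
      DirectSum.lof K (KoszulIndex k i) (fun T => X.obj T.1) T'
        ((X.map g').hom ((X.map f').hom x)) := by
  subst h
  rw [← ModuleCat.comp_apply, ← ModuleCat.comp_apply, ← X.map_comp, ← X.map_comp,
    Subsingleton.elim (f ≫ g) (f' ≫ g')]

theorem koszulD_comp {K : Type u} [Field K] {k : ℕ} (X : Cube k (ModuleCat.{u} K)) (i : ℕ) :
    koszulD X i ∘ₗ koszulD X (i + 1) = 0 := by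
  refine DirectSum.linearMap_ext K fun S => LinearMap.ext fun x => ?_
  simp only [LinearMap.comp_apply, LinearMap.zero_apply]
  rw [koszulD_lof, map_sum]
  simp only [map_zsmul, koszulD_lof, Finset.smul_sum, smul_smul]
  rw [Finset.sum_sigma']
  have hne : ∀ p : (t : {t : Fin k // t ∉ S.1}) × {u : Fin k // u ∉ (S.insert t).1},
      p.2.1 ∉ S.1 ∧ p.1.1 ≠ p.2.1 := fun p => by
    have h := p.2.2
    simp only [KoszulIndex.insert, Finset.mem_insert, not_or] at h
    exact ⟨h.2, fun e => h.1 e.symm⟩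
  refine Finset.sum_involution
    (fun p _ => ⟨⟨p.2.1, (hne p).1⟩, ⟨p.1.1, by
      simp only [KoszulIndex.insert, Finset.mem_insert, not_or]
      exact ⟨(hne p).2, p.1.2⟩⟩⟩) ?_ ?_ ?_ ?_
  · rintro ⟨t, u⟩ -
    have h := hne ⟨t, u⟩
    have e := koszulSign_swap S.1 t.1 u.1 t.2 h.1 h.2
    have ht : t.1 ∉ (S.insert ⟨u.1, h.1⟩).1 := by
      simp only [KoszulIndex.insert, Finset.mem_insert, not_or]
      exact ⟨h.2, t.2⟩
    have c := koszul_lof_congr X i x (T := (S.insert t).insert u)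
      (T' := (S.insert ⟨u.1, h.1⟩).insert ⟨t.1, ht⟩)
      (homOfLE (S.le_insert t)) (homOfLE ((S.insert t).le_insert u))
      (homOfLE (S.le_insert ⟨u.1, h.1⟩)) (homOfLE ((S.insert ⟨u.1, h.1⟩).le_insert ⟨t.1, ht⟩))
      (Subtype.ext (Finset.insert_comm _ _ _))
    refine (congrArg₂ (· + ·) (congrArg (_ • ·) c) rfl).trans ?_
    refine (add_smul _ _ _).symm.trans ?_
    exact (congrArg (· • _) e).trans (zero_smul ℤ _)
  · rintro ⟨t, u⟩ - - heq
    exact (hne ⟨t, u⟩).2 (congrArg (fun p => p.1.1) heq).symm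
  · intros
    exact Finset.mem_sigma.2 ⟨Finset.mem_univ _, Finset.mem_univ _⟩
  · intros
    rfl

/-- The Koszul complex of a cube of vector spaces. -/
def koszulComplex {K : Type u} [Field K] {k : ℕ} (X : Cube k (ModuleCat.{u} K)) :
    ChainComplex (ModuleCat.{u} K) ℕ :=
  ChainComplex.of (fun i => ModuleCat.of K (KoszulObj X i))
    (fun i => ModuleCat.ofHom (koszulD X i))
    (fun i => by
      rw [← ModuleCat.ofHom_comp, koszulD_comp]
      rfl)

/-- A persistence module `F` is `k`-middle-exact if, for every strongly bicartesian `k`-cube in `P`,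
the Koszul complex of its image under `F` has trivial homology in all degrees `0 < i < k`. -/
def IsMiddleExact {K : Type u} [Field K] {P : Type v} [PartialOrder P] (k : ℕ)
    (F : P ⥤ ModuleCat.{u} K) : Prop :=
  ∀ X : Cube k P, IsStronglyBicartesian X →
    ∀ i : ℕ, 0 < i → i < k → IsZero ((koszulComplex (X ⋙ F)).homology i)

/-- The product of a finite family of total orders, with the product partial order. -/
def ProductPoset {N : ℕ} (S : Fin N → Type v) : Type v := ∀ j, S j

instance {N : ℕ} (S : Fin N → Type v) [∀ j, LinearOrder (S j)] :
    PartialOrder (ProductPoset S) :=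
  inferInstanceAs (PartialOrder (∀ j, S j))

end Persistence

end

/-!
Apply middle exactness to the cubes which move from a point to a larger one in some of the
coordinates. In degree `k - 1` it says that elements which die outside a principal down-set lift
along the edges of the product, and in degree `1` that being born outside a principal up-set
descends along them; both properties pass to direct summands. Suppose they hold for `F ≠ 0`. If some
structure map is not injective, let `y` be a maximal point where an element of its kernel survives,
and lift the resulting element of `F(y)` down as far as possible, to `F(a)`; otherwise take `y` to
be the top element and start from a nonzero element of `F(a)` for a minimal `a` with `F(a) ≠ 0`.
Either way an element of `F(a)` dies outside `Iic y`, while its image in `F(y)` is not born outside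
`Ici a`. A functional on `F(y)` which detects this image retracts `F` onto the interval module of
`[a, y]`, and the theorem follows by induction on the total dimension.
-/

noncomputable section

namespace Persistence

section Modules

/-- Persistence modules over `K` indexed by `P`. -/
abbrev PersistenceModule (K : Type u) [Field K] (P : Type v) [PartialOrder P] :=
  P ⥤ ModuleCat.{u} K

variable {K : Type u} [Field K] {P : Type v} [PartialOrder P] {F G : PersistenceModule K P}

/-- The structure map of a persistence module from `x` to `y`. -/
def transition (F : PersistenceModule K P) {x y : P} (h : x ≤ y) : F.obj x →ₗ[K] F.obj y :=
  (F.map (homOfLE h)).hom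

@[simp]
theorem transition_self {x : P} (h : x ≤ x) (v : F.obj x) : transition F h v = v :=
  congrArg (fun f => ModuleCat.Hom.hom f v) (F.map_id x)

@[simp]
theorem transition_transition {x y z : P} (h : x ≤ y) (h' : y ≤ z) (v : F.obj x) :
    transition F h' (transition F h v) = transition F (h.trans h') v :=
  congrArg (fun f => ModuleCat.Hom.hom f v) (F.map_comp (homOfLE h) (homOfLE h')).symm

/-- The linear map `F(x) → G(x)` of a morphism of persistence modules. -/
def component (f : F ⟶ G) (x : P) : F.obj x →ₗ[K] G.obj x :=
  (f.app x).hom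

theorem component_transition (f : F ⟶ G) {x y : P} (h : x ≤ y) (v : F.obj x) :
    component f y (transition F h v) = transition G h (component f x v) :=
  congrArg (fun g => ModuleCat.Hom.hom g v) (f.naturality (homOfLE h))

/-- The elements of `F(x)` which vanish at every point of `U` above `x`. -/
def dyingOn (F : PersistenceModule K P) (U : Set P) (x : P) : Submodule K (F.obj x) :=
  ⨅ z ∈ U, ⨅ h : x ≤ z, LinearMap.ker (transition F h)

/-- The subspace of `F(x)` spanned by the images of the `F(z)` for the points `z` of `D` below
`x`. -/
def bornIn (F : PersistenceModule K P) (D : Set P) (x : P) : Submodule K (F.obj x) :=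
  ⨆ z ∈ D, ⨆ h : z ≤ x, LinearMap.range (transition F h)

theorem mem_dyingOn {U : Set P} {x : P} {v : F.obj x} :
    v ∈ dyingOn F U x ↔ ∀ z ∈ U, ∀ h : x ≤ z, transition F h v = 0 := by
  simp only [dyingOn, Submodule.mem_iInf, LinearMap.mem_ker]

theorem bornIn_le_iff {D : Set P} {x : P} {W : Submodule K (F.obj x)} :
    bornIn F D x ≤ W ↔ ∀ z ∈ D, ∀ (h : z ≤ x) (w : F.obj z), transition F h w ∈ W := by
  simp only [bornIn, iSup_le_iff, LinearMap.range_le_iff_comap, Submodule.eq_top_iff',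
    Submodule.mem_comap]

theorem transition_mem_bornIn {D : Set P} {x z : P} (hz : z ∈ D) (h : z ≤ x) (v : F.obj z) :
    transition F h v ∈ bornIn F D x :=
  bornIn_le_iff.1 le_rfl z hz h v

theorem bornIn_mono {D D' : Set P} (h : D ⊆ D') (x : P) : bornIn F D x ≤ bornIn F D' x :=
  biSup_mono h

theorem dyingOn_anti {U U' : Set P} (h : U ⊆ U') (x : P) : dyingOn F U' x ≤ dyingOn F U x :=
  biInf_mono h

theorem component_mem_dyingOn (f : F ⟶ G) {U : Set P} {x : P} {v : F.obj x}
    (hv : v ∈ dyingOn F U x) : component f x v ∈ dyingOn G U x :=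
  mem_dyingOn.2 fun z hz h => by rw [← component_transition, mem_dyingOn.1 hv z hz h, map_zero]

theorem component_mem_bornIn (f : F ⟶ G) {D : Set P} {x : P} {v : F.obj x}
    (hv : v ∈ bornIn F D x) : component f x v ∈ bornIn G D x := by
  have hle : bornIn F D x ≤ (bornIn G D x).comap (component f x) :=
    bornIn_le_iff.2 fun z hz h w => by
      rw [Submodule.mem_comap, component_transition]
      exact transition_mem_bornIn hz h _
  exact hle hv

theorem component_retract (e : Retract F G) (x : P) (v : F.obj x) :
    component e.r x (component e.i x v) = v :=
  congrArg (fun f : F ⟶ F => (f.app x).hom v) e.retract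

theorem dyingOn_le_dyingOn_comp {Q : Type w} [PartialOrder Q] (X : Q ⥤ P) (U : Set P) (a : Q) :
    dyingOn F U (X.obj a) ≤ dyingOn (X ⋙ F) (X.obj ⁻¹' U) a := fun _ hv =>
  mem_dyingOn.2 fun b hb hab => mem_dyingOn.1 hv (X.obj b) hb (X.monotone hab)

theorem bornIn_comp_le_bornIn {Q : Type w} [PartialOrder Q] (X : Q ⥤ P) (D : Set P) (a : Q) :
    bornIn (X ⋙ F) (X.obj ⁻¹' D) a ≤ bornIn F D (X.obj a) :=
  bornIn_le_iff.2 fun _ hb hba w => transition_mem_bornIn (F := F) hb (X.monotone hba) w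

end Modules

section Koszul

variable {K : Type u} [Field K] {k i : ℕ}

theorem card_insert_add_of_notMem {S : Finset (Fin k)} (hS : S.card + (i + 1) = k) {t : Fin k}
    (ht : t ∉ S) : (insert t S).card + i = k :=
  (KoszulIndex.insert ⟨S, hS⟩ ⟨t, ht⟩).2

theorem card_compl_singleton_add (t : Fin k) : ({t}ᶜ : Finset (Fin k)).card + 1 = k := by
  rw [← Finset.card_singleton t, Finset.card_compl_add_card, Fintype.card_fin]

theorem isUnit_koszulSign (S : Finset (Fin k)) (t : Fin k) : IsUnit (koszulSign S t) :=
  isUnit_one.neg.pow _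

theorem koszulSign_compl_singleton (t : Fin k) : koszulSign {t}ᶜ t = 1 := by
  simp [koszulSign, Finset.filter_singleton]

variable (X : Cube k (ModuleCat.{u} K))

/-- The inclusion of the summand `X(S)` into the Koszul complex. -/
def koszulIncl {S : Finset (Fin k)} (hS : S.card + i = k) : X.obj S →ₗ[K] KoszulObj X i :=
  DirectSum.lof K (KoszulIndex k i) (fun T => X.obj T.1) ⟨S, hS⟩

/-- The projection of the Koszul complex to the summand `X(S)`. -/
def koszulProj {S : Finset (Fin k)} (hS : S.card + i = k) : KoszulObj X i →ₗ[K] X.obj S :=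
  DirectSum.component K (KoszulIndex k i) (fun T => X.obj T.1) ⟨S, hS⟩

@[elab_as_elim]
theorem koszulObj_induction {p : KoszulObj X i → Prop} (zero : p 0)
    (add : ∀ w w', p w → p w' → p (w + w'))
    (incl : ∀ (S : Finset (Fin k)) (hS : S.card + i = k) (v : X.obj S), p (koszulIncl X hS v))
    (w : KoszulObj X i) : p w :=
  DirectSum.induction_on w zero (fun S v => incl S.1 S.2 v) add

theorem koszulProj_koszulIncl_self {S : Finset (Fin k)} (hS : S.card + i = k) (v : X.obj S) :
    koszulProj X hS (koszulIncl X hS v) = v :=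
  DirectSum.component.lof_self ..

theorem koszulProj_koszulIncl_of_ne {S T : Finset (Fin k)} (hS : S.card + i = k)
    (hT : T.card + i = k) (h : S ≠ T) (v : X.obj S) :
    koszulProj X hT (koszulIncl X hS v) = 0 :=
  (DirectSum.component.of ..).trans (dif_neg fun h' => h (congrArg Subtype.val h'))

theorem koszulD_koszulIncl {S : Finset (Fin k)} (hS : S.card + (i + 1) = k) (v : X.obj S) :
    koszulD X i (koszulIncl X hS v) = ∑ t : {t // t ∉ S}, koszulSign S t.1 •
      koszulIncl X (card_insert_add_of_notMem hS t.2)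
        (transition X (Finset.subset_insert t.1 S) v) :=
  koszulD_lof X i ⟨S, hS⟩ v

theorem koszulProj_koszulD_koszulIncl {S : Finset (Fin k)} (hS : S.card + (i + 1) = k)
    {t : Fin k} (ht : t ∉ S) (v : X.obj S) :
    koszulProj X (card_insert_add_of_notMem hS ht) (koszulD X i (koszulIncl X hS v)) =
      koszulSign S t • transition X (Finset.subset_insert t S) v := by
  rw [koszulD_koszulIncl, map_sum, Fintype.sum_eq_single ⟨t, ht⟩]
  · rw [map_zsmul, koszulProj_koszulIncl_self]
  · intro s hs
    rw [map_zsmul, koszulProj_koszulIncl_of_ne, smul_zero]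
    exact fun h => hs (Subtype.ext ((Finset.insert_inj s.2).1 h))

theorem koszulProj_koszulD_mem_bornIn {T : Finset (Fin k)} (hT : T.card + i = k)
    (w : KoszulObj X (i + 1)) : koszulProj X hT (koszulD X i w) ∈ bornIn X (Set.Iio T) T := by
  induction w using koszulObj_induction with
  | zero => simp only [map_zero, zero_mem]
  | add w w' hw hw' => simpa only [map_add] using add_mem hw hw'
  | incl S hS v =>
    rw [koszulD_koszulIncl, map_sum]
    refine sum_mem fun t _ => ?_
    rw [map_zsmul]
    refine Submodule.smul_of_tower_mem _ _ ?_
    by_cases h : insert t.1 S = T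
    · subst h
      rw [koszulProj_koszulIncl_self]
      exact transition_mem_bornIn (Set.mem_Iio.2 (Finset.ssubset_insert t.2)) _ v
    · rw [koszulProj_koszulIncl_of_ne X _ _ h]
      exact zero_mem _

theorem surjective_koszulIncl_empty (h : (∅ : Finset (Fin k)).card + i = k) :
    Function.Surjective (koszulIncl X h) := by
  intro w
  induction w using koszulObj_induction with
  | zero => exact ⟨0, map_zero _⟩
  | add w w' hw hw' =>
    obtain ⟨v, rfl⟩ := hw
    obtain ⟨v', rfl⟩ := hw'
    exact ⟨v + v', map_add _ _ _⟩
  | incl S hS v =>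
    obtain rfl : S = ∅ := Finset.card_eq_zero.1 (Nat.add_right_cancel (hS.trans h.symm))
    exact ⟨v, rfl⟩

theorem koszulD_koszulIncl_compl_singleton (t : Fin k) (v : X.obj {t}ᶜ) :
    koszulD X 0 (koszulIncl X (card_compl_singleton_add t) v) =
      koszulIncl X (Finset.card_fin k) (transition X (Finset.subset_univ _) v) := by
  have ht : t ∉ ({t}ᶜ : Finset (Fin k)) := by simp
  have koszulIncl_eq {S T : Finset (Fin k)} (hS : S.card + 0 = k) (hT : T.card + 0 = k)
      (h : S = T) (hS' : {t}ᶜ ≤ S) (hT' : {t}ᶜ ≤ T) :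
      koszulIncl X hS (transition X hS' v) = koszulIncl X hT (transition X hT' v) := by
    subst h
    rfl
  rw [koszulD_koszulIncl, Fintype.sum_eq_single ⟨t, ht⟩, koszulSign_compl_singleton, one_smul]
  · exact koszulIncl_eq _ _ (Finset.insert_compl_self t) _ _
  · exact fun s hs => absurd (Subtype.ext (by simpa using s.2)) hs

theorem exact_koszulD_of_isZero_homology (i : ℕ)
    (h : IsZero ((koszulComplex X).homology (i + 1))) :
    Function.Exact (koszulD X (i + 1)) (koszulD X i) := by
  rw [← HomologicalComplex.exactAt_iff_isZero_homology,
    HomologicalComplex.exactAt_iff' _ (i + 2) (i + 1) i (by simp) (by simp),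
    ShortComplex.ShortExact.moduleCat_exact_iff_function_exact] at h
  have d_eq (j : ℕ) : (koszulComplex X).d (j + 1) j = ModuleCat.ofHom (koszulD X j) :=
    ChainComplex.of_d (fun i => ModuleCat.of K (KoszulObj X i))
      (fun i => ModuleCat.ofHom (koszulD X i)) j
  change Function.Exact ((koszulComplex X).d (i + 1 + 1) (i + 1)).hom
    ((koszulComplex X).d (i + 1) i).hom at h
  rwa [d_eq, d_eq] at h

variable {X}

theorem dyingOn_singleton_le_map (hi : i + 2 = k)
    (hX : Function.Exact (koszulD X (i + 1)) (koszulD X i)) (t : Fin k) :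
    dyingOn X (Set.Iic {t})ᶜ {t} ≤
      (dyingOn X (Set.Iic {t})ᶜ ∅).map (transition X (Finset.empty_subset _)) := by
  intro v hv
  have hempty : (∅ : Finset (Fin k)).card + (i + 1 + 1) = k := by
    rwa [Finset.card_empty, zero_add]
  have hsingleton (s : Fin k) : ({s} : Finset (Fin k)).card + (i + 1) = k := by
    rw [Finset.card_singleton]
    omega
  obtain ⟨w, hw⟩ : koszulIncl X (hsingleton t) v ∈ Set.range (koszulD X (i + 1)) := by
    refine (hX _).1 ?_
    rw [koszulD_koszulIncl]
    refine Finset.sum_eq_zero fun s _ => ?_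
    rw [mem_dyingOn.1 hv _ (fun h => s.2 (h (Finset.mem_insert_self _ _))), map_zero, smul_zero]
  obtain ⟨u, rfl⟩ := surjective_koszulIncl_empty X hempty w
  have proj_eq (s : Fin k) :
      koszulProj X (hsingleton s) (koszulIncl X (hsingleton t) v) =
        koszulSign ∅ s • transition X (Finset.empty_subset {s}) u := by
    rw [← hw]
    exact koszulProj_koszulD_koszulIncl X hempty (Finset.notMem_empty s) u
  refine ⟨koszulSign ∅ t • u, mem_dyingOn.2 fun T hT h => ?_, ?_⟩
  · obtain ⟨s, hsT, hs⟩ := Finset.not_subset.1 hT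
    have hne : ({t} : Finset (Fin k)) ≠ {s} := fun h => by simp [h] at hs
    have dies : transition X (Finset.empty_subset {s}) u = 0 := by
      rw [← (isUnit_koszulSign ∅ s).smul_eq_zero, ← proj_eq, koszulProj_koszulIncl_of_ne X _ _ hne]
    rw [map_zsmul, ← transition_transition (Finset.empty_subset {s})
      (Finset.singleton_subset_iff.2 hsT), dies, map_zero, smul_zero]
  · rw [map_zsmul, ← proj_eq, koszulProj_koszulIncl_self]

theorem comap_bornIn_univ_le (hX : Function.Exact (koszulD X 1) (koszulD X 0)) (t : Fin k) :
    (bornIn X (Set.Ici {t}ᶜ)ᶜ Finset.univ).comap (transition X (Finset.subset_univ {t}ᶜ)) ≤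
      bornIn X (Set.Ici {t}ᶜ)ᶜ {t}ᶜ := by
  intro v hv
  have bornIn_le : bornIn X (Set.Ici {t}ᶜ)ᶜ Finset.univ ≤
      ((LinearMap.ker (koszulProj X (card_compl_singleton_add t))).map (koszulD X 0)).comap
        (koszulIncl X (Finset.card_fin k)) := by
    rw [bornIn_le_iff]
    intro T hT h v
    obtain ⟨s, hs, hsT⟩ := Finset.not_subset.1 hT
    have hle : T ≤ {s}ᶜ := Finset.subset_compl_singleton.2 hsT
    have hne : ({s}ᶜ : Finset (Fin k)) ≠ {t}ᶜ := fun h => by simp [← h] at hs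
    refine ⟨koszulIncl X (card_compl_singleton_add s) (transition X hle v),
      koszulProj_koszulIncl_of_ne X _ _ hne _, ?_⟩
    rw [koszulD_koszulIncl_compl_singleton, transition_transition]
  obtain ⟨w, hw, hwv⟩ := Submodule.mem_map.1 (bornIn_le hv)
  obtain ⟨y, hy⟩ : koszulIncl X (card_compl_singleton_add t) v - w ∈ Set.range (koszulD X 1) := by
    refine (hX _).1 ?_
    rw [map_sub, hwv, koszulD_koszulIncl_compl_singleton, sub_self]
  have := koszulProj_koszulD_mem_bornIn X (card_compl_singleton_add t) y
  rw [hy, map_sub, LinearMap.mem_ker.1 hw, sub_zero, koszulProj_koszulIncl_self] at this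
  exact bornIn_mono (fun _ hT => not_le_of_gt (Set.mem_Iio.1 hT)) _ this

end Koszul

section Cubes

variable {K : Type u} [Field K] {P : Type v} {k : ℕ}

section Lattice

variable [Lattice P]

/-- The cube in a lattice `P` given by a lattice homomorphism from the subsets of `Fin k`. -/
def latticeCube (f : LatticeHom (Finset (Fin k)) P) : Cube k P :=
  (OrderHomClass.mono f).functor

theorem isStronglyCartesian_latticeCube (f : LatticeHom (Finset (Fin k)) P) :
    IsStronglyCartesian (latticeCube f) := by
  intro A B hAB hcard
  obtain ⟨t, ht, t', ht', hne⟩ := Finset.one_lt_card.1 hcard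
  have pt_le (c : Cone ((Subtype.mono_coe (· ∈ Set.Ioc A B)).functor ⋙ latticeCube f)) :
      c.pt ≤ f A := by
    have pt_le_insert (s) (hs : s ∈ B \ A) : c.pt ≤ f (insert s A) := by
      rw [Finset.mem_sdiff] at hs
      exact leOfHom (c.π.app ⟨insert s A, Finset.ssubset_insert hs.2,
        Finset.insert_subset hs.1 hAB⟩)
    have inf_eq : insert t A ⊓ insert t' A = A := by grind
    calc c.pt ≤ f (insert t A) ⊓ f (insert t' A) :=
          le_inf (pt_le_insert t ht) (pt_le_insert t' ht')
      _ = f A := by rw [← map_inf, inf_eq]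
  exact ⟨{ lift := fun c => homOfLE (pt_le c)
           fac := fun _ _ => Subsingleton.elim _ _
           uniq := fun _ _ _ => Subsingleton.elim _ _ }⟩

theorem isStronglyCocartesian_latticeCube (f : LatticeHom (Finset (Fin k)) P) :
    IsStronglyCocartesian (latticeCube f) := by
  intro A B hAB hcard
  obtain ⟨t, ht, t', ht', hne⟩ := Finset.one_lt_card.1 hcard
  have le_pt (c : Cocone ((Subtype.mono_coe (· ∈ Set.Ico A B)).functor ⋙ latticeCube f)) :
      f B ≤ c.pt := by
    have erase_le_pt (s) (hs : s ∈ B \ A) : f (B.erase s) ≤ c.pt := by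
      rw [Finset.mem_sdiff] at hs
      exact leOfHom (c.ι.app ⟨B.erase s, Finset.subset_erase.2 ⟨hAB, hs.2⟩,
        Finset.erase_ssubset hs.1⟩)
    have sup_eq : B.erase t ⊔ B.erase t' = B := by grind
    calc f B = f (B.erase t) ⊔ f (B.erase t') := by rw [← map_sup, sup_eq]
      _ ≤ c.pt := sup_le (erase_le_pt t ht) (erase_le_pt t' ht')
  exact ⟨{ desc := fun c => homOfLE (le_pt c)
           fac := fun _ _ => Subsingleton.elim _ _
           uniq := fun _ _ _ => Subsingleton.elim _ _ }⟩

theorem isStronglyBicartesian_latticeCube (f : LatticeHom (Finset (Fin k)) P) :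
    IsStronglyBicartesian (latticeCube f) :=
  ⟨isStronglyCartesian_latticeCube f, isStronglyCocartesian_latticeCube f⟩

end Lattice

variable [PartialOrder P] {F : PersistenceModule K P} {X : Cube k P}

theorem IsMiddleExact.exact_koszulD (hF : IsMiddleExact k F) (hX : IsStronglyBicartesian X)
    {i : ℕ} (hi : i + 1 < k) : Function.Exact (koszulD (X ⋙ F) (i + 1)) (koszulD (X ⋙ F) i) :=
  exact_koszulD_of_isZero_homology _ i (hF X hX (i + 1) i.succ_pos hi)

theorem IsMiddleExact.dyingOn_le_map (hF : IsMiddleExact k F) (hX : IsStronglyBicartesian X)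
    (hk : 2 ≤ k) {t : Fin k} {x x' : P} (hx : X.obj {t} = x) (hx' : X.obj ∅ = x') (h : x' ≤ x)
    {U : Set P} (hU : (Set.Iic {t})ᶜ ⊆ X.obj ⁻¹' U)
    (hU' : ∀ z ∈ U, x' ≤ z → x ≤ z ∨ ∃ s ≠ t, X.obj {s} ≤ z) :
    dyingOn F U x ≤ (dyingOn F U x').map (transition F h) := by
  subst hx hx'
  intro v hv
  obtain ⟨i, rfl⟩ := Nat.exists_eq_add_of_le' hk
  obtain ⟨u, hu, huv⟩ :=
    dyingOn_singleton_le_map rfl (hF.exact_koszulD hX (Nat.lt_succ_self _)) t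
      (dyingOn_anti hU _ (dyingOn_le_dyingOn_comp X U _ hv))
  change transition F h u = v at huv
  refine ⟨u, mem_dyingOn.2 fun z hz hle => ?_, huv⟩
  rcases hU' z hz hle with hxz | ⟨s, hs, hsz⟩
  · rw [← transition_transition h hxz, huv]
    exact mem_dyingOn.1 hv z hz hxz
  · have hle' : X.obj ∅ ≤ X.obj {s} := X.monotone (Finset.empty_subset _)
    have dies : transition F hle' u = 0 :=
      mem_dyingOn.1 hu {s} (fun h => hs (Finset.singleton_subset_singleton.1 h))
        (Finset.empty_subset _)
    rw [← transition_transition hle' hsz, dies, map_zero]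

theorem IsMiddleExact.comap_bornIn_le (hF : IsMiddleExact k F) (hX : IsStronglyBicartesian X)
    (hk : 2 ≤ k) {t : Fin k} {x x' : P} (hx : X.obj {t}ᶜ = x) (hx' : X.obj Finset.univ = x')
    (h : x ≤ x') {D : Set P} (hD : (Set.Ici {t}ᶜ)ᶜ ⊆ X.obj ⁻¹' D)
    (hD' : ∀ z ∈ D, z ≤ x' → z ≤ x ∨ ∃ s ≠ t, z ≤ X.obj {s}ᶜ) :
    (bornIn F D x').comap (transition F h) ≤ bornIn F D x := by
  subst hx hx'
  intro v hv
  have hle : bornIn F D (X.obj Finset.univ) ≤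
      bornIn (X ⋙ F) (Set.Ici {t}ᶜ)ᶜ Finset.univ ⊔ (bornIn F D _).map (transition F h) := by
    rw [bornIn_le_iff]
    intro z hz hle w
    rcases hD' z hz hle with hzx | ⟨s, hs, hzs⟩
    · refine Submodule.mem_sup_right ⟨transition F hzx w, transition_mem_bornIn hz hzx w, ?_⟩
      exact transition_transition hzx h w
    · have hs' : {s}ᶜ ∈ (Set.Ici ({t}ᶜ : Finset (Fin k)))ᶜ := fun h =>
        hs (Finset.singleton_subset_singleton.1 (compl_le_compl_iff_le.1 h))
      rw [← transition_transition hzs (X.monotone (Finset.subset_univ _))]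
      exact Submodule.mem_sup_left
        (transition_mem_bornIn (F := X ⋙ F) hs' (Finset.subset_univ _) (transition F hzs w))
  obtain ⟨a, ha, _, ⟨b, hb, rfl⟩, hab⟩ := Submodule.mem_sup.1 (hle hv)
  have hvb : v - b ∈ bornIn (X ⋙ F) (Set.Ici {t}ᶜ)ᶜ {t}ᶜ := by
    refine comap_bornIn_univ_le (hF.exact_koszulD hX hk) t (Submodule.mem_comap.2 ?_)
    have : transition F h (v - b) = a := by rw [map_sub, ← hab, add_sub_cancel_right]
    exact this ▸ ha
  have hvb' : v - b ∈ bornIn F D (X.obj {t}ᶜ) :=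
    bornIn_comp_le_bornIn X D _ (bornIn_mono hD _ hvb)
  exact sub_add_cancel v b ▸ add_mem hvb' hb

end Cubes

section Coordinates

variable {ι : Type w} {S : ι → Type v} {k : ℕ}

theorem exists_embedding_range_eq [Finite ι] {T : Set ι} {j j' : ι} (hj : j ∈ T) (hj' : j' ∈ T)
    (hne : j ≠ j') : ∃ (k : ℕ) (e : Fin k ↪ ι) (t : Fin k),
      2 ≤ k ∧ k ≤ Nat.card ι ∧ Set.range e = T ∧ e t = j :=
  ⟨T.ncard, (Finite.equivFin T).symm.toEmbedding.trans (.subtype _), Finite.equivFin T ⟨j, hj⟩,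
    (Set.one_lt_ncard_iff T.toFinite).2 ⟨j, j', hj, hj', hne⟩, T.ncard_le_card,
    ((Finite.equivFin T).symm.surjective.range_comp Subtype.val).trans Subtype.range_val,
    congrArg Subtype.val ((Finite.equivFin T).symm_apply_apply ⟨j, hj⟩)⟩

theorem pi_le_of_forall_ne [∀ i, Preorder (S i)] {x y : ∀ i, S i} (j : ι) (hj : x j ≤ y j)
    (h : ∀ i ≠ j, x i ≤ y i) : x ≤ y := fun i =>
  (eq_or_ne i j).elim (fun hi => hi ▸ hj) (h i)

theorem coordinatewise_induction [Finite ι] [∀ i, Preorder (S i)] {x' x : ∀ i, S i}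
    (h : x' ≤ x) {p : (∀ i, S i) → Prop} (base : p x)
    (step : ∀ y z : ∀ i, S i, ∀ j, x' ≤ y → y ≤ z → z ≤ x → (∀ i ≠ j, y i = z i) →
      x' j ≠ x j → p z → p y) : p x' := by
  classical
  have := Fintype.ofFinite ι
  suffices hp : ∀ T : Finset ι, p (T.piecewise x' x) by simpa using hp Finset.univ
  intro T
  induction T using Finset.induction_on with
  | empty => rwa [Finset.piecewise_empty]
  | insert j T hj ih =>
    by_cases hjx : x' j = x j
    · rwa [Finset.piecewise_insert, hjx, ← Finset.piecewise_eq_of_notMem T x' x hj,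
        Function.update_eq_self]
    · refine step _ _ j (Finset.le_piecewise_of_le_of_le _ le_rfl h) ?_
        (Finset.piecewise_le_of_le_of_le _ h le_rfl)
        (fun i hi => Finset.piecewise_insert_of_ne _ _ _ hi) hjx ih
      rw [Finset.piecewise_insert, update_le_self_iff, Finset.piecewise_eq_of_notMem _ _ _ hj]
      exact h j

section Cube

variable [DecidableEq ι] [∀ i, Lattice (S i)] (e : Fin k ↪ ι) {lo hi : ∀ i, S i} (h : lo ≤ hi)

/-- The cube in a product of lattices which moves from `lo` to `hi` in the coordinates `e t`. -/
def coordinateCube : LatticeHom (Finset (Fin k)) (∀ i, S i) where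
  toFun A := (A.map e).piecewise hi lo
  map_sup' A B := by
    funext i
    by_cases hA : i ∈ A.map e <;> by_cases hB : i ∈ B.map e <;>
      simp [Finset.piecewise, Finset.map_union, Finset.mem_union, hA, hB, h i, -Finset.mem_map]
  map_inf' A B := by
    funext i
    by_cases hA : i ∈ A.map e <;> by_cases hB : i ∈ B.map e <;>
      simp [Finset.piecewise, Finset.map_inter, Finset.mem_inter, hA, hB, h i, -Finset.mem_map]

theorem coordinateCube_apply (A : Finset (Fin k)) :
    coordinateCube e h A = (A.map e).piecewise hi lo :=
  rfl

theorem coordinateCube_empty : coordinateCube e h ∅ = lo := by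
  rw [coordinateCube_apply, Finset.map_empty, Finset.piecewise_empty]

theorem coordinateCube_singleton (t : Fin k) :
    coordinateCube e h {t} = Function.update lo (e t) (hi (e t)) := by
  rw [coordinateCube_apply, Finset.map_singleton, Finset.piecewise_singleton]

variable {e}

theorem coordinateCube_compl (he : ∀ i ∉ Set.range e, lo i = hi i) (A : Finset (Fin k)) :
    coordinateCube e h Aᶜ = (A.map e).piecewise lo hi := by
  funext i
  rw [coordinateCube_apply]
  by_cases hi : i ∈ Set.range e
  · obtain ⟨t, rfl⟩ := hi
    by_cases t ∈ A <;> simp_all [Finset.piecewise]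
  · simp [Finset.piecewise, he i hi]

theorem coordinateCube_univ (he : ∀ i ∉ Set.range e, lo i = hi i) :
    coordinateCube e h Finset.univ = hi := by
  rw [← Finset.compl_empty, coordinateCube_compl h he, Finset.map_empty, Finset.piecewise_empty]

theorem coordinateCube_compl_singleton (he : ∀ i ∉ Set.range e, lo i = hi i) (t : Fin k) :
    coordinateCube e h {t}ᶜ = Function.update hi (e t) (lo (e t)) := by
  rw [coordinateCube_compl h he, Finset.map_singleton, Finset.piecewise_singleton]

end Cube

variable {K : Type u} [Field K] [∀ i, LinearOrder (S i)] {F : PersistenceModule K (∀ i, S i)}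

/-- Elements which die outside `Iic y` lift along the edges in each direction `j`, as long as `y`
is not maximal in some other direction. -/
def HasLifting (F : PersistenceModule K (∀ i, S i)) : Prop :=
  ∀ ⦃x' x y : ∀ i, S i⦄ (h : x' ≤ x) (j : ι), x ≤ y → (∀ i ≠ j, x' i = x i) →
    (∃ i ≠ j, ¬IsMax (y i)) →
      dyingOn F (Set.Iic y)ᶜ x ≤ (dyingOn F (Set.Iic y)ᶜ x').map (transition F h)

/-- Being born outside `Ici a` descends along the edges in each direction `j`, as long as `a` is
not minimal in some other direction. -/
def HasDescent (F : PersistenceModule K (∀ i, S i)) : Prop :=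
  ∀ ⦃a x x' : ∀ i, S i⦄ (h : x ≤ x') (j : ι), a ≤ x → (∀ i ≠ j, x i = x' i) →
    (∃ i ≠ j, ¬IsMin (a i)) →
      (bornIn F (Set.Ici a)ᶜ x').comap (transition F h) ≤ bornIn F (Set.Ici a)ᶜ x

theorem HasLifting.of_retract {G : PersistenceModule K (∀ i, S i)} (hG : HasLifting G)
    (e : Retract F G) : HasLifting F := by
  intro x' x y h j hxy hj hmax v hv
  obtain ⟨u, hu, huv⟩ := hG h j hxy hj hmax (component_mem_dyingOn e.i hv)
  exact ⟨component e.r x' u, component_mem_dyingOn e.r hu, by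
    rw [← component_transition, huv, component_retract]⟩

theorem HasDescent.of_retract {G : PersistenceModule K (∀ i, S i)} (hG : HasDescent G)
    (e : Retract F G) : HasDescent F := by
  intro a x x' h j hax hj hmin v hv
  have mem_bornIn : component e.i x v ∈ bornIn G (Set.Ici a)ᶜ x := by
    refine hG h j hax hj hmin ?_
    rw [Submodule.mem_comap, ← component_transition]
    exact component_mem_bornIn e.i hv
  rw [← component_retract e x v]
  exact component_mem_bornIn e.r mem_bornIn

theorem exists_lt_of_not_le {x y : ∀ i, S i} (h : ¬x ≤ y) : ∃ i, y i < x i := by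
  simpa only [Pi.le_def, not_forall, not_le] using h

theorem IsMiddleExact.dyingOn_le_map_of_covBy [DecidableEq ι] (hF : IsMiddleExact k F)
    (hk : 2 ≤ k) {e : Fin k ↪ ι} {t : Fin k} {x' x hi y : ∀ i, S i} (h : x' ≤ x) (hle : x' ≤ hi)
    (hx : Function.update x' (e t) (hi (e t)) = x) (hxy : x ≤ y)
    (hcov : ∀ s ≠ t, y (e s) ⋖ hi (e s)) (hmax : ∀ i ∉ Set.range e, IsMax (y i)) :
    dyingOn F (Set.Iic y)ᶜ x ≤ (dyingOn F (Set.Iic y)ᶜ x').map (transition F h) := by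
  refine hF.dyingOn_le_map (isStronglyBicartesian_latticeCube (coordinateCube e hle)) hk
    ((coordinateCube_singleton e hle t).trans hx) (coordinateCube_empty e hle) h
    (fun A hA hAy => ?_) fun z hz hxz => ?_
  · obtain ⟨s, hsA, hst⟩ := Finset.not_subset.1 hA
    have obj_apply : coordinateCube e hle A (e s) = hi (e s) := by
      rw [coordinateCube_apply, Finset.piecewise_eq_of_mem _ _ _ (Finset.mem_map_of_mem e hsA)]
    exact (hcov s fun h => hst (Finset.mem_singleton.2 h)).lt.not_ge
      (obj_apply.symm.trans_le (hAy (e s)))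
  · obtain ⟨i, hi⟩ := exists_lt_of_not_le hz
    obtain ⟨s, rfl⟩ : i ∈ Set.range e := by_contra fun h => hi.not_isMax (hmax i h)
    by_cases hst : s = t
    · subst hst hx
      exact Or.inl (update_le_iff.2 ⟨(Function.update_self (e s) _ x').symm.trans_le
        ((hxy (e s)).trans hi.le), fun l _ => hxz l⟩)
    · exact Or.inr ⟨s, hst, (coordinateCube_singleton e hle s).trans_le
        (update_le_iff.2 ⟨(hcov s hst).ge_of_gt hi, fun l _ => hxz l⟩)⟩

theorem IsMiddleExact.comap_bornIn_le_of_covBy [DecidableEq ι] (hF : IsMiddleExact k F)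
    (hk : 2 ≤ k) {e : Fin k ↪ ι} {t : Fin k} {a lo x x' : ∀ i, S i} (h : x ≤ x') (hle : lo ≤ x')
    (hlo : ∀ i ∉ Set.range e, lo i = x' i) (hx : Function.update x' (e t) (lo (e t)) = x)
    (hax : a ≤ x) (hcov : ∀ s ≠ t, lo (e s) ⋖ a (e s)) (hmin : ∀ i ∉ Set.range e, IsMin (a i)) :
    (bornIn F (Set.Ici a)ᶜ x').comap (transition F h) ≤ bornIn F (Set.Ici a)ᶜ x := by
  refine hF.comap_bornIn_le (isStronglyBicartesian_latticeCube (coordinateCube e hle)) hk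
    ((coordinateCube_compl_singleton hle hlo t).trans hx) (coordinateCube_univ hle hlo) h
    (fun A hA haA => ?_) fun z hz hzx' => ?_
  · obtain ⟨s, hst, hsA⟩ := Finset.not_subset.1 hA
    have obj_apply : coordinateCube e hle A (e s) = lo (e s) := by
      rw [coordinateCube_apply, Finset.piecewise_eq_of_notMem _ _ _ (by simpa using hsA)]
    exact (hcov s fun h => Finset.mem_compl.1 hst (Finset.mem_singleton.2 h)).lt.not_ge
      ((haA (e s)).trans_eq obj_apply)
  · obtain ⟨i, hi⟩ := exists_lt_of_not_le hz
    obtain ⟨s, rfl⟩ : i ∈ Set.range e := by_contra fun h => hi.not_isMin (hmin i h)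
    by_cases hst : s = t
    · subst hst hx
      exact Or.inl (le_update_iff.2 ⟨(hi.le.trans (hax (e s))).trans_eq
        (Function.update_self (e s) _ x'), fun l _ => hzx' l⟩)
    · exact Or.inr ⟨s, hst, (le_update_iff.2 ⟨(hcov s hst).le_of_lt hi,
        fun l _ => hzx' l⟩).trans_eq (coordinateCube_compl_singleton hle hlo s).symm⟩

theorem hasLifting_of_isMiddleExact [Finite ι] [∀ i, SuccOrder (S i)]
    (hF : ∀ k, 2 ≤ k → k ≤ Nat.card ι → IsMiddleExact k F) : HasLifting F := by
  classical
  intro x' x y h j hxy hj ⟨j', hj', hmax⟩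
  obtain ⟨k, e, t, hk, hkι, he, rfl⟩ : ∃ (k : ℕ) (e : Fin k ↪ ι) (t : Fin k),
      2 ≤ k ∧ k ≤ Nat.card ι ∧ Set.range e = {i | i = j ∨ ¬IsMax (y i)} ∧ e t = j :=
    exists_embedding_range_eq (Or.inl rfl) (Or.inr hmax) hj'.symm
  let hi := Function.update (fun i => Order.succ (y i)) (e t) (x (e t))
  have hle : x' ≤ hi :=
    le_update_iff.2 ⟨h _, fun i hi => (hj i hi).trans_le ((hxy i).trans (Order.le_succ _))⟩
  have update_eq : Function.update x' (e t) (hi (e t)) = x :=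
    Function.update_eq_iff.2 ⟨Function.update_self .., hj⟩
  refine (hF k hk hkι).dyingOn_le_map_of_covBy hk h hle update_eq hxy
    (fun s hs => ?_) fun i hi => ?_
  · have hst : e s ≠ e t := e.injective.ne hs
    have hmax : ¬IsMax (y (e s)) := (he.subset ⟨s, rfl⟩).resolve_left hst
    have hi_apply : hi (e s) = Order.succ (y (e s)) := Function.update_of_ne hst ..
    exact hi_apply ▸ Order.covBy_succ_of_not_isMax hmax
  · rw [he, Set.mem_ofPred_eq, not_or, not_not] at hi
    exact hi.2

theorem hasDescent_of_isMiddleExact [Finite ι] [∀ i, PredOrder (S i)]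
    (hF : ∀ k, 2 ≤ k → k ≤ Nat.card ι → IsMiddleExact k F) : HasDescent F := by
  classical
  intro a x x' h j hax hj ⟨j', hj', hmin⟩
  obtain ⟨k, e, t, hk, hkι, he, rfl⟩ : ∃ (k : ℕ) (e : Fin k ↪ ι) (t : Fin k),
      2 ≤ k ∧ k ≤ Nat.card ι ∧ Set.range e = {i | i = j ∨ ¬IsMin (a i)} ∧ e t = j :=
    exists_embedding_range_eq (Or.inl rfl) (Or.inr hmin) hj'.symm
  have notMem_range {i : ι} (hi : i ∉ Set.range e) : i ≠ e t ∧ IsMin (a i) := by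
    rwa [he, Set.mem_ofPred_eq, not_or, not_not] at hi
  let lo :=
    Function.update (fun i => if IsMin (a i) then x' i else Order.pred (a i)) (e t) (x (e t))
  have hle : lo ≤ x' := by
    refine update_le_iff.2 ⟨h _, fun i _ => ?_⟩
    split_ifs
    · exact le_rfl
    · exact (Order.pred_le _).trans ((hax i).trans (h i))
  have lo_eq (i) (hi : i ∉ Set.range e) : lo i = x' i :=
    (Function.update_of_ne (notMem_range hi).1 ..).trans (if_pos (notMem_range hi).2)
  have update_eq : Function.update x' (e t) (lo (e t)) = x :=
    Function.update_eq_iff.2 ⟨Function.update_self .., fun i hi => (hj i hi).symm⟩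
  refine (hF k hk hkι).comap_bornIn_le_of_covBy hk h hle lo_eq update_eq hax (fun s hs => ?_)
    fun i hi => (notMem_range hi).2
  have hst : e s ≠ e t := e.injective.ne hs
  have hmin : ¬IsMin (a (e s)) := (he.subset ⟨s, rfl⟩).resolve_left hst
  have lo_apply : lo (e s) = Order.pred (a (e s)) :=
    (Function.update_of_ne hst ..).trans (if_neg hmin)
  exact lo_apply ▸ Order.pred_covBy_of_not_isMin hmin

theorem HasLifting.dyingOn_le_map [Finite ι] (hF : HasLifting F) {x' x y : ∀ i, S i}
    (h : x' ≤ x) (hxy : x ≤ y) (hmax : ∀ j, x' j ≠ x j → ∃ i ≠ j, ¬IsMax (y i)) :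
    dyingOn F (Set.Iic y)ᶜ x ≤ (dyingOn F (Set.Iic y)ᶜ x').map (transition F h) := by
  refine coordinatewise_induction h (p := fun z => ∀ h : z ≤ x,
    dyingOn F (Set.Iic y)ᶜ x ≤ (dyingOn F (Set.Iic y)ᶜ z).map (transition F h))
    (fun h v hv => ⟨v, hv, transition_self h v⟩) ?_ h
  intro p q j _ hpq hqx hj hjx ih h v hv
  obtain ⟨w, hw, rfl⟩ := ih hqx hv
  obtain ⟨u, hu, rfl⟩ := hF hpq j (hqx.trans hxy) hj (hmax j hjx) hw
  exact ⟨u, hu, (transition_transition hpq hqx u).symm⟩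

theorem HasDescent.comap_bornIn_le [Finite ι] (hF : HasDescent F)
    (hinj : ∀ ⦃x y : ∀ i, S i⦄ (h : x ≤ y), Function.Injective (transition F h))
    {a x x' : ∀ i, S i} (hax : a ≤ x) (h : x ≤ x') :
    (bornIn F (Set.Ici a)ᶜ x').comap (transition F h) ≤ bornIn F (Set.Ici a)ᶜ x := by
  refine coordinatewise_induction h (p := fun z => ∀ h : z ≤ x',
    (bornIn F (Set.Ici a)ᶜ x').comap (transition F h) ≤ bornIn F (Set.Ici a)ᶜ z)
    (fun h v hv => by rwa [Submodule.mem_comap, transition_self] at hv) ?_ h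
  intro p q j hxp hpq hqx' hj _ ih h v hv
  rw [Submodule.mem_comap, ← transition_transition hpq hqx'] at hv
  replace hv := ih hqx' hv
  by_cases hmin : ∃ i ≠ j, ¬IsMin (a i)
  · exact hF hpq j (hax.trans hxp) hj hmin hv
  · push Not at hmin
    have hle : bornIn F (Set.Ici a)ᶜ q ≤ (bornIn F (Set.Ici a)ᶜ p).map (transition F hpq) := by
      refine bornIn_le_iff.2 fun z hz hzq w => ?_
      obtain ⟨i, hi⟩ := exists_lt_of_not_le hz
      obtain rfl : i = j := by_contra fun hij => hi.not_isMin (hmin i hij)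
      have hzp : z ≤ p := pi_le_of_forall_ne i (hi.le.trans (hax.trans hxp i)) fun l hl =>
        (hzq l).trans_eq (hj l hl).symm
      exact ⟨transition F hzp w, transition_mem_bornIn hz hzp w, transition_transition hzp hpq w⟩
    obtain ⟨w, hw, hwv⟩ := hle hv
    exact hinj hpq hwv ▸ hw

end Coordinates

section BoxGenerator

variable {K : Type u} [Field K]

/-- A persistence module has a box generator if some element of some `F(a)` dies outside `Iic b`,
for some `b ≥ a`, and its image in `F(b)` does not come from outside `Ici a`. It then generates a
direct summand, the interval module of `[a, b]`. -/
def HasBoxGenerator {P : Type v} [PartialOrder P] (F : PersistenceModule K P) : Prop :=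
  ∃ (a b : P) (h : a ≤ b), ∃ u ∈ dyingOn F (Set.Iic b)ᶜ a,
    transition F h u ∉ bornIn F (Set.Ici a)ᶜ b

theorem exists_ne_zero_mem_dyingOn {P : Type v} [PartialOrder P] [Finite P]
    {F : PersistenceModule K P} {x x' : P} (h : x ≤ x') {v : F.obj x} (hv : v ≠ 0)
    (hv' : transition F h v = 0) :
    ∃ y, ¬x' ≤ y ∧ ∃ u ∈ dyingOn F (Set.Iic y)ᶜ y, u ≠ 0 := by
  obtain ⟨y, ⟨hxy, hne⟩, hmax⟩ := (Set.toFinite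
    {y | ∃ h : x ≤ y, transition F h v ≠ 0}).exists_maximal ⟨x, le_rfl, by rwa [transition_self]⟩
  refine ⟨y, fun hx'y => hne ?_, transition F hxy v, mem_dyingOn.2 fun z hz hyz => ?_, hne⟩
  · rw [← transition_transition h hx'y, hv', map_zero]
  · rw [transition_transition]
    exact by_contra fun hne => hz (hmax ⟨_, hne⟩ hyz)

-- Otherwise `F.obj x` refers to the product category structure on `∀ i, S i`.
local instance {ι : Type w} {S : ι → Type v} [∀ i, Preorder (S i)] : Category (∀ i, S i) :=
  Preorder.smallCategory _

variable {ι : Type w} {S : ι → Type v} [∀ i, LinearOrder (S i)]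
  {F : PersistenceModule K (∀ i, S i)}

theorem comap_dyingOn_le {q y : ∀ i, S i} (h : q ≤ y) (j : ι) (hj : ∀ i ≠ j, q i = y i)
    (hmax : ∀ i ≠ j, IsMax (y i)) :
    (dyingOn F (Set.Iic y)ᶜ y).comap (transition F h) ≤ dyingOn F (Set.Iic y)ᶜ q := by
  refine fun w hw => mem_dyingOn.2 fun z hz hqz => ?_
  obtain ⟨i, hi⟩ := exists_lt_of_not_le hz
  obtain rfl : i = j := by_contra fun hij => hi.not_isMax (hmax i hij)
  have hyz : y ≤ z := pi_le_of_forall_ne i hi.le fun l hl => (hj l hl).symm.trans_le (hqz l)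
  rw [← transition_transition h hyz]
  exact mem_dyingOn.1 hw z hz hyz

theorem bornIn_le_range_of_covBy [DecidableEq ι] {o y : ∀ i, S i} (ho : ∀ z, o ≤ z) {j : ι}
    {c d : S j} (hd : d ⋖ c) (h : Function.update y j d ≤ y) :
    bornIn F (Set.Ici (Function.update o j c))ᶜ y ≤ LinearMap.range (transition F h) := by
  refine bornIn_le_iff.2 fun z hz hzy w => ?_
  have hzc : z j < c := not_le.1 fun h => hz (update_le_iff.2 ⟨h, fun i _ => ho z i⟩)
  exact ⟨transition F (le_update_iff.2 ⟨hd.le_of_lt hzc, fun i _ => hzy i⟩) w,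
    transition_transition _ h w⟩

variable [Finite ι] [∀ i, Finite (S i)]

theorem HasLifting.hasBoxGenerator_of_two_not_isMax (hF : HasLifting F) {y : ∀ i, S i} {j j' : ι}
    (hne : j ≠ j') (hj : ¬IsMax (y j)) (hj' : ¬IsMax (y j')) {v : F.obj y}
    (hv : v ∈ dyingOn F (Set.Iic y)ᶜ y) (hv0 : v ≠ 0) : HasBoxGenerator F := by
  have : Nonempty (∀ i, S i) := ⟨y⟩
  obtain ⟨o, ho⟩ := Finite.exists_ge (id : (∀ i, S i) → ∀ i, S i)
  obtain ⟨u, hu, rfl⟩ := hF.dyingOn_le_map (ho y) le_rfl (fun i _ =>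
    (eq_or_ne j i).elim (fun h => ⟨j', h ▸ hne.symm, hj'⟩) fun h => ⟨j, h, hj⟩) hv
  have bornIn_le : bornIn F (Set.Ici o)ᶜ y ≤ ⊥ := bornIn_le_iff.2 fun z hz => absurd (ho z) hz
  exact ⟨o, y, ho y, u, hu, fun hborn => hv0 ((Submodule.mem_bot K).1 (bornIn_le hborn))⟩

theorem HasLifting.hasBoxGenerator_of_isMax (hF : HasLifting F) {y : ∀ i, S i} {j : ι}
    (hj : ¬IsMax (y j)) (hmax : ∀ i ≠ j, IsMax (y i)) {v : F.obj y}
    (hv : v ∈ dyingOn F (Set.Iic y)ᶜ y) (hv0 : v ≠ 0) : HasBoxGenerator F := by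
  classical
  have : Nonempty (∀ i, S i) := ⟨y⟩
  obtain ⟨o, ho⟩ := Finite.exists_ge (id : (∀ i, S i) → ∀ i, S i)
  let C : Set (S j) := {c | ∃ h : Function.update o j c ≤ y,
    v ∈ (dyingOn F (Set.Iic y)ᶜ (Function.update o j c)).map (transition F h)}
  have apply_mem_C {q : ∀ i, S i} (hq : q ≤ y)
      (hvq : v ∈ (dyingOn F (Set.Iic y)ᶜ q).map (transition F hq)) : q j ∈ C := by
    have hle : Function.update o j (q j) ≤ q := update_le_iff.2 ⟨le_rfl, fun i _ => ho q i⟩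
    obtain ⟨w, hw, rfl⟩ := hvq
    obtain ⟨u, hu, rfl⟩ := hF.dyingOn_le_map hle hq
      (fun i hi => ⟨j, fun hji => hi (hji ▸ Function.update_self ..), hj⟩) hw
    exact ⟨hle.trans hq, u, hu, (transition_transition hle hq u).symm⟩
  obtain ⟨c, ⟨hc, u, hu, huv⟩, hcmin⟩ := C.toFinite.exists_minimal
    ⟨y j, apply_mem_C le_rfl ⟨v, hv, transition_self _ v⟩⟩
  refine ⟨Function.update o j c, y, hc, u, hu, fun hborn => ?_⟩
  rw [huv] at hborn
  by_cases hmin : IsMin c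
  · have bornIn_le : bornIn F (Set.Ici (Function.update o j c))ᶜ y ≤ ⊥ :=
      bornIn_le_iff.2 fun z hz => absurd (update_le_iff.2
        ⟨hmin.isBot (z j), fun i _ => ho z i⟩) hz
    exact hv0 ((Submodule.mem_bot K).1 (bornIn_le hborn))
  · obtain ⟨d, hd⟩ := exists_covBy_of_wellFoundedGT hmin
    have hq : Function.update y j d ≤ y :=
      update_le_self_iff.2 (hd.le.trans ((update_le_iff.1 hc).1))
    obtain ⟨w, rfl⟩ := bornIn_le_range_of_covBy ho hd hq hborn
    have hw : w ∈ dyingOn F (Set.Iic y)ᶜ (Function.update y j d) :=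
      comap_dyingOn_le hq j (fun i hi => Function.update_of_ne hi ..) hmax hv
    have hdC := apply_mem_C hq ⟨w, hw, rfl⟩
    rw [Function.update_self] at hdC
    exact hd.lt.not_ge (hcmin hdC hd.le)

theorem HasDescent.hasBoxGenerator_of_injective (hF : HasDescent F)
    (hinj : ∀ ⦃x y : ∀ i, S i⦄ (h : x ≤ y), Function.Injective (transition F h))
    {x : ∀ i, S i} {v : F.obj x} (hv : v ≠ 0) : HasBoxGenerator F := by
  obtain ⟨a, ⟨u, hu⟩, hmin⟩ := (Set.toFinite {x | ∃ u : F.obj x, u ≠ 0}).exists_minimal ⟨x, v, hv⟩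
  have : Nonempty (∀ i, S i) := ⟨a⟩
  obtain ⟨b, hb⟩ := Finite.exists_le (id : (∀ i, S i) → ∀ i, S i)
  have bornIn_le : bornIn F (Set.Ici a)ᶜ a ≤ ⊥ := bornIn_le_iff.2 fun z hz hza w => by
    obtain rfl : w = 0 := by_contra fun hw => hz (hmin ⟨w, hw⟩ hza)
    rw [map_zero]
    exact zero_mem _
  exact ⟨a, b, hb a, u, mem_dyingOn.2 fun z hz => absurd (hb z) hz, fun hborn =>
    hu ((Submodule.mem_bot K).1 (bornIn_le (hF.comap_bornIn_le hinj le_rfl (hb a) hborn)))⟩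

theorem HasLifting.hasBoxGenerator (hL : HasLifting F) (hD : HasDescent F) {x : ∀ i, S i}
    {v : F.obj x} (hv : v ≠ 0) : HasBoxGenerator F := by
  by_cases hinj : ∀ ⦃x y : ∀ i, S i⦄ (h : x ≤ y), Function.Injective (transition F h)
  · exact hD.hasBoxGenerator_of_injective hinj hv
  push Not at hinj
  obtain ⟨x, x', h, hinj⟩ := hinj
  obtain ⟨v, hv', hv⟩ : ∃ v, transition F h v = 0 ∧ v ≠ 0 := by
    simpa only [injective_iff_map_eq_zero, not_forall, exists_prop] using hinj
  obtain ⟨y, hx'y, u, hu, hu0⟩ := exists_ne_zero_mem_dyingOn h hv hv'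
  obtain ⟨j, hj⟩ := exists_lt_of_not_le hx'y
  by_cases hmax : ∀ i ≠ j, IsMax (y i)
  · exact hL.hasBoxGenerator_of_isMax hj.not_isMax hmax hu hu0
  · push Not at hmax
    obtain ⟨j', hne, hj'⟩ := hmax
    exact hL.hasBoxGenerator_of_two_not_isMax hne hj' hj.not_isMax hu hu0

end BoxGenerator

section IntervalModules

variable {K : Type u} [Field K] {P : Type v} [PartialOrder P]

/-- The interval `[a, b]` of a poset. -/
def PosetInterval.Icc {a b : P} (hab : a ≤ b) : PosetInterval P where
  carrier := Set.Icc a b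
  nonempty := Set.nonempty_Icc.2 hab
  convex _ _ _ hx hy hxz hzy := ⟨hx.1.trans hxz, hzy.trans hy.2⟩
  zigzag _ _ hx hy := .tail (.single ⟨hx, Set.left_mem_Icc.2 hab, .inr hx.1⟩)
    ⟨Set.left_mem_Icc.2 hab, hy, .inl hy.1⟩

theorem intervalFiber_eq_zero {I : PosetInterval P} {x : P} (hx : x ∉ I.carrier)
    (c : (intervalModule K I).obj x) : c = 0 :=
  Subtype.ext ((Submodule.mem_bot K).1 ((if_neg hx : intervalFiber K I x = ⊥).le c.2))

theorem mem_intervalFiber {I : PosetInterval P} {x : P} (hx : x ∈ I.carrier) (c : K) :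
    c ∈ intervalFiber K I x :=
  (if_pos hx : intervalFiber K I x = ⊤).ge Submodule.mem_top

theorem coe_transition_intervalModule {I : PosetInterval P} {x y : P} (hx : x ∈ I.carrier)
    (hy : y ∈ I.carrier) (h : x ≤ y) (c : (intervalModule K I).obj x) :
    (transition (intervalModule K I) h c).1 = c.1 := by
  change (intervalMap K I x y c).1 = c.1
  rw [intervalMap, dif_pos ⟨hx, hy⟩]
  rfl

variable {F G : PersistenceModule K P} {a b : P} (hab : a ≤ b)

/-- The morphism of persistence modules with the given components. -/
def homOfComponents (f : ∀ x, F.obj x →ₗ[K] G.obj x)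
    (hf : ∀ ⦃x y⦄ (h : x ≤ y) (v : F.obj x), f y (transition F h v) = transition G h (f x v)) :
    F ⟶ G where
  app x := ModuleCat.ofHom (f x)
  naturality _ _ g := ModuleCat.hom_ext (LinearMap.ext (hf (leOfHom g)))

open Classical in
/-- The component at `x` of `iccInclusion`. -/
def iccInclusionComponent (u : F.obj a) (x : P) :
    (intervalModule K (.Icc hab)).obj x →ₗ[K] F.obj x :=
  if h : a ≤ x then
    LinearMap.toSpanSingleton K (F.obj x) (transition F h u) ∘ₗ
      (intervalFiber K (.Icc hab) x).subtype
  else 0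

theorem iccInclusionComponent_apply (u : F.obj a) {x : P} (h : a ≤ x)
    (c : (intervalModule K (.Icc hab)).obj x) :
    iccInclusionComponent hab u x c = c.1 • transition F h u := by
  rw [iccInclusionComponent, dif_pos h]
  rfl

/-- The morphism from the interval module of `[a, b]` to `F` determined by an element of `F(a)`
which dies outside `Iic b`. -/
def iccInclusion {u : F.obj a} (hu : u ∈ dyingOn F (Set.Iic b)ᶜ a) :
    intervalModule K (.Icc hab) ⟶ F :=
  homOfComponents (iccInclusionComponent hab u) fun x y h c => by
    by_cases hx : x ∈ Set.Icc a b
    · have hay : a ≤ y := hx.1.trans h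
      rw [iccInclusionComponent_apply hab u hay, iccInclusionComponent_apply hab u hx.1, map_smul,
        transition_transition]
      by_cases hy : y ≤ b
      · rw [coe_transition_intervalModule (I := .Icc hab) hx ⟨hay, hy⟩]
      · rw [mem_dyingOn.1 hu y hy, smul_zero, smul_zero]
    · rw [intervalFiber_eq_zero (I := .Icc hab) hx c]
      simp only [map_zero]

open Classical in
/-- The component at `x` of `iccProjection`. -/
def iccProjectionComponent (f : F.obj b →ₗ[K] K) (x : P) :
    F.obj x →ₗ[K] (intervalModule K (.Icc hab)).obj x :=
  if h : x ∈ Set.Icc a b then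
    LinearMap.codRestrict (intervalFiber K (.Icc hab) x) (f ∘ₗ transition F h.2)
      fun _ => mem_intervalFiber (I := .Icc hab) h _
  else 0

theorem coe_iccProjectionComponent (f : F.obj b →ₗ[K] K) {x : P} (h : x ∈ Set.Icc a b)
    (v : F.obj x) : (iccProjectionComponent hab f x v).1 = f (transition F h.2 v) :=
  congrArg (fun g : F.obj x →ₗ[K] (intervalModule K (.Icc hab)).obj x => (g v).1) (dif_pos h)

/-- The morphism from `F` to the interval module of `[a, b]` determined by a functional on `F(b)`
which vanishes on the elements born outside `Ici a`. -/
def iccProjection {f : F.obj b →ₗ[K] K} (hf : bornIn F (Set.Ici a)ᶜ b ≤ LinearMap.ker f) :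
    F ⟶ intervalModule K (.Icc hab) :=
  homOfComponents (iccProjectionComponent hab f) fun x y h v => by
    by_cases hy : y ∈ Set.Icc a b
    · refine Subtype.ext ?_
      rw [coe_iccProjectionComponent hab f hy, transition_transition]
      by_cases hx : a ≤ x
      · rw [coe_transition_intervalModule (I := .Icc hab) ⟨hx, h.trans hy.2⟩ hy,
          coe_iccProjectionComponent hab f ⟨hx, h.trans hy.2⟩]
      · rw [intervalFiber_eq_zero (I := .Icc hab) (fun h => hx h.1)
          (iccProjectionComponent hab f x v), map_zero]
        exact hf (transition_mem_bornIn hx (h.trans hy.2) v)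
    · exact (intervalFiber_eq_zero (I := .Icc hab) hy _).trans
        (intervalFiber_eq_zero (I := .Icc hab) hy _).symm

theorem iccInclusion_iccProjection {u : F.obj a} (hu : u ∈ dyingOn F (Set.Iic b)ᶜ a)
    {f : F.obj b →ₗ[K] K} (hf : bornIn F (Set.Ici a)ᶜ b ≤ LinearMap.ker f)
    (huf : f (transition F hab u) = 1) :
    iccInclusion hab hu ≫ iccProjection hab hf = 𝟙 _ := by
  refine NatTrans.ext (funext fun x => ModuleCat.hom_ext (LinearMap.ext fun
    (c : (intervalModule K (.Icc hab)).obj x) => ?_))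
  change iccProjectionComponent hab f x (iccInclusionComponent hab u x c) = c
  by_cases hx : x ∈ Set.Icc a b
  · refine Subtype.ext ?_
    rw [coe_iccProjectionComponent hab f hx, iccInclusionComponent_apply hab u hx.1, map_smul,
      map_smul, transition_transition, huf, smul_eq_mul, mul_one]
  · exact (intervalFiber_eq_zero (I := .Icc hab) hx _).trans
      (intervalFiber_eq_zero (I := .Icc hab) hx _).symm

theorem HasBoxGenerator.exists_retract (hF : HasBoxGenerator F) :
    ∃ I, Nonempty (Retract (intervalModule K I) F) := by
  obtain ⟨a, b, hab, u, hu, hborn⟩ := hF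
  obtain ⟨f, hfu, hf⟩ := Submodule.exists_le_ker_of_notMem hborn
  have hg : bornIn F (Set.Ici a)ᶜ b ≤ LinearMap.ker ((f (transition F hab u))⁻¹ • f) :=
    fun v hv => by
      rw [LinearMap.mem_ker, LinearMap.smul_apply, LinearMap.mem_ker.1 (hf hv), smul_zero]
  exact ⟨.Icc hab, ⟨⟨iccInclusion hab hu, iccProjection hab hg,
    iccInclusion_iccProjection hab hu hg (inv_mul_cancel₀ hfu)⟩⟩⟩

end IntervalModules

section Decomposition

variable {K : Type u} [Field K] {P : Type v} [PartialOrder P] {F G : PersistenceModule K P}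

theorem isZero_of_forall_eq_zero (h : ∀ (x : P) (v : F.obj x), v = 0) : IsZero F :=
  Functor.isZero F fun x =>
    have : Subsingleton (F.obj x) := subsingleton_of_forall_eq 0 (h x)
    ModuleCat.isZero_of_subsingleton _

theorem IsIntervalDecomposable.of_isZero (hF : IsZero F) : IsIntervalDecomposable F :=
  ⟨PEmpty, PEmpty.elim, ⟨hF.isInitial.uniqueUpToIso
    (isColimitEquivIsInitialOfIsEmpty _ _ (colimit.isColimit _))⟩⟩

theorem isIntervalDecomposable_intervalModule (I : PosetInterval P) :
    IsIntervalDecomposable (intervalModule K I) :=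
  ⟨PUnit, fun _ => I, ⟨(coproductUniqueIso fun _ => intervalModule K I).symm⟩⟩

theorem IsIntervalDecomposable.of_isColimit {c : BinaryCofan F G} (hc : IsColimit c)
    (hF : IsIntervalDecomposable F) (hG : IsIntervalDecomposable G) :
    IsIntervalDecomposable c.pt := by
  obtain ⟨ι, I, ⟨eF⟩⟩ := hF
  obtain ⟨κ, J, ⟨eG⟩⟩ := hG
  refine ⟨ι ⊕ κ, Sum.elim I J, ?_⟩
  change Nonempty (_ ≅ ∐ (intervalModule K ∘ Sum.elim I J))
  rw [Sum.comp_elim]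
  exact ⟨(Cofan.combPairIsColimit (colimit.isColimit _) (colimit.isColimit _)
    (BinaryCofan.isColimitCompRightIso _ eG.inv
      (BinaryCofan.isColimitCompLeftIso _ eF.inv hc))).coconePointUniqueUpToIso
        (colimit.isColimit _)⟩

theorem component_injective_of_retract (e : Retract F G) (x : P) :
    Function.Injective (component e.i x) :=
  Function.LeftInverse.injective (component_retract e x)

theorem IsPFD.of_retract (hG : IsPFD G) (e : Retract F G) : IsPFD F := fun x =>
  have : FiniteDimensional K (G.obj x) := hG x
  Module.Finite.of_injective _ (component_injective_of_retract e x)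

/-- The first summand of a binary bicone, as a retract of its point. -/
def retractOfBinaryBicone (b : BinaryBicone F G) : Retract F b.pt :=
  ⟨b.inl, b.fst, b.inl_fst⟩

theorem finrank_lt_of_binaryBicone (b : BinaryBicone F G) {x : P}
    [FiniteDimensional K (b.pt.obj x)] {c : G.obj x} (hc : c ≠ 0) :
    Module.finrank K (F.obj x) < Module.finrank K (b.pt.obj x) := by
  rw [← LinearMap.finrank_range_of_inj (component_injective_of_retract (retractOfBinaryBicone b) x)]
  refine Submodule.finrank_lt fun htop => hc ?_
  obtain ⟨w, hw⟩ := LinearMap.range_eq_top.1 htop (component b.inr x c)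
  calc
    c = component b.snd x (component b.inr x c) :=
      (congrArg (fun f => component f x c) b.inr_snd).symm
    _ = component b.snd x (component b.inl x w) := congrArg _ hw.symm
    _ = 0 := congrArg (fun f => component f x w) b.inl_snd

theorem isIntervalDecomposable_of_exists_retract [Finite P] {Q : PersistenceModule K P → Prop}
    (hQ : ∀ ⦃F G : PersistenceModule K P⦄, Retract F G → Q G → Q F)
    (hsplit : ∀ F, Q F → ¬IsZero F → ∃ I, Nonempty (Retract (intervalModule K I) F))
    (hF : Q F) (hpfd : IsPFD F) : IsIntervalDecomposable F := by
  have := Fintype.ofFinite P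
  induction hn : ∑ x, Module.finrank K (F.obj x) using Nat.strong_induction_on generalizing F with
  | _ n ih =>
    by_cases hzero : IsZero F
    · exact .of_isZero hzero
    obtain ⟨I, ⟨e⟩⟩ := hsplit F hF hzero
    let b := binaryBiconeOfIsSplitEpiOfKernel (kernelIsKernel e.r)
    have hb : b.IsBilimit := isBilimitBinaryBiconeOfIsSplitEpiOfKernel (kernelIsKernel e.r)
    have e' : Retract (kernel e.r) F := retractOfBinaryBicone b
    refine .of_isColimit hb.isColimit (ih _ ?_ (hQ e' hF) (hpfd.of_retract e') rfl)
      (isIntervalDecomposable_intervalModule I)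
    obtain ⟨x, hx⟩ := I.nonempty
    have hfin (y : P) : FiniteDimensional K (F.obj y) := hpfd y
    rw [← hn]
    refine Finset.sum_lt_sum
      (fun y _ => LinearMap.finrank_le_finrank_of_injective (component_injective_of_retract e' y))
      ⟨x, Finset.mem_univ x, ?_⟩
    have : FiniteDimensional K (b.pt.obj x) := hfin x
    exact finrank_lt_of_binaryBicone b (c := ⟨1, mem_intervalFiber hx 1⟩)
      fun h => one_ne_zero (congrArg Subtype.val h)

theorem isIntervalDecomposable_of_hasLifting_of_hasDescent {ι : Type w} [Finite ι]
    {S : ι → Type v} [∀ i, LinearOrder (S i)] [∀ i, Finite (S i)]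
    {F : PersistenceModule K (∀ i, S i)} (hL : HasLifting F) (hD : HasDescent F) (hF : IsPFD F) :
    IsIntervalDecomposable F := by
  refine isIntervalDecomposable_of_exists_retract
    (Q := fun G : PersistenceModule K (∀ i, S i) => HasLifting G ∧ HasDescent G)
    (fun _ _ e hG => ⟨hG.1.of_retract e, hG.2.of_retract e⟩) (fun G hG hzero => ?_) ⟨hL, hD⟩ hF
  obtain ⟨x, v, hv⟩ := by simpa only [not_forall] using mt isZero_of_forall_eq_zero hzero
  exact (hG.1.hasBoxGenerator hG.2 hv).exists_retract

end Decomposition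

end Persistence

end

theorem mainTheorem7 {K : Type u} [Field K] {N : ℕ} {S : Fin N → Type v}
    [∀ j, LinearOrder (S j)] [∀ j, Finite (S j)]
    (F : Persistence.ProductPoset S ⥤ ModuleCat.{u} K) (hF : Persistence.IsPFD F)
    (hexact : ∀ k : ℕ, 2 ≤ k → k ≤ N → Persistence.IsMiddleExact k F) :
    Persistence.IsIntervalDecomposable F := by
  let succOrder (j : Fin N) : SuccOrder (S j) := .ofLinearWellFoundedLT (S j)
  let predOrder (j : Fin N) : PredOrder (S j) := .ofLinearWellFoundedGT (S j)
  have exact_of_le_card (k : ℕ) (hk : 2 ≤ k) (hkN : k ≤ Nat.card (Fin N)) :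
      Persistence.IsMiddleExact (P := ∀ j, S j) k F :=
    hexact k hk (hkN.trans_eq (Nat.card_fin N))
  exact Persistence.isIntervalDecomposable_of_hasLifting_of_hasDescent
    (Persistence.hasLifting_of_isMiddleExact exact_of_le_card)
    (Persistence.hasDescent_of_isMiddleExact exact_of_le_card) hF
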